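/- Let $K\subset\mathbb{C}$ be an algebraic number field, i.e. a subfield with $[K:\mathbb{Q}]<\infty$, and write $\zeta_m=e^{2\pi i/m}$. For a prime $\ell$ let $$m(K,\ell)=\min\{m\ge 1 \mid K\cap\mathbb{Q}(\zeta_{\ell^m})=K\cap\mathbb{Q}(\zeta_{\ell^{k}})\text{ for all }k\ge m\},$$ which exists because $[K:\mathbb{Q}]<\infty$, and put $$t(K,\ell)=[\mathbb{Q}(\zeta_{\ell^{m(K,\ell)}}):K\cap\mathbb{Q}(\zeta_{\ell^{m(K,\ell)}})].$$ For $n\ge 0$ define Schur's constant $$S(n,K)=2^{\,n-\lfloor n/t(K,2)\rfloor}\prod_{\ell}\ell^{\,m(K,\ell)\left\lfloor\frac{n}{t(K,\ell)}\right\rfloor+\left\lfloor\frac{n}{\ell\,t(K,\ell)}\right\rfloor+\left\lfloor\frac{n}{\ell^2 t(K,\ell)}\right\rfloor+\cdots},$$ where $\ell$ runs over all primes (including $2$); almost all factors are $1$. For a positive integer $a$ and a prime $\ell$, let $a_\ell$ denote the largest power of $\ell$ dividing $a$. **Proposition.** Let $\mathcal{G}$ be a finite subgroup of $\mathrm{GL}_n(\mathbb{C})$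 such that $\operatorname{tr}(g)\in K$ for all $g\in\mathcal{G}$. Then $|\mathcal{G}|_\ell$ divides $S(n,K)$ for every odd prime $\ell$. -/

import Mathlib

open scoped MatrixGroups

namespace SchurBound

/-- The standard primitive `m`-th root of unity `ζ_m = e^{2πi/m}` in `ℂ`. -/
noncomputable def zeta (m : ℕ) : ℂ := Complex.exp (2 * Real.pi * Complex.I / m)

/-- The cyclotomic field `ℚ(ζ_m)` as a subfield of `ℂ`. -/
noncomputable def cyclo (m : ℕ) : IntermediateField ℚ ℂ := IntermediateField.adjoin ℚ {zeta m}

/-- The set of all `m ≥ 1` with `K ∩ ℚ(ζ_{ℓ^m}) = K ∩ ℚ(ζ_{ℓ^(m+1)}) = ⋯`. -/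
def stableLevels (K : IntermediateField ℚ ℂ) (ℓ : ℕ) : Set ℕ :=
  {m | 1 ≤ m ∧ ∀ k, m ≤ k → K ⊓ cyclo (ℓ ^ k) = K ⊓ cyclo (ℓ ^ m)}

/-- `m(K,ℓ)`, the least `m ≥ 1` with `K ∩ ℚ(ζ_{ℓ^m}) = K ∩ ℚ(ζ_{ℓ^(m+1)}) = ⋯`.
It exists when `K` is a number field: see `stableLevels_nonempty`. -/
noncomputable def levelM (K : IntermediateField ℚ ℂ) (ℓ : ℕ) : ℕ := sInf (stableLevels K ℓ)

/-- `t(K,ℓ) = [ℚ(ζ_{ℓ^m}) : K ∩ ℚ(ζ_{ℓ^m})]` with `m = m(K,ℓ)`. -/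
noncomputable def degreeT (K : IntermediateField ℚ ℂ) (ℓ : ℕ) : ℕ :=
  IntermediateField.relfinrank (K ⊓ cyclo (ℓ ^ levelM K ℓ)) (cyclo (ℓ ^ levelM K ℓ))

/-- The exponent `m ⌊n/t⌋ + ⌊n/(ℓ t)⌋ + ⌊n/(ℓ² t)⌋ + ⋯` with `m = m(K,ℓ)`, `t = t(K,ℓ)`.
The sum may stop at `i = n`, because `ℓ ^ i > n` for `i > n`: see `div_eq_zero_of_gt`. -/
noncomputable def schurExponent (n : ℕ) (K : IntermediateField ℚ ℂ) (ℓ : ℕ) : ℕ :=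
  levelM K ℓ * (n / degreeT K ℓ) + ∑ i ∈ Finset.Icc 1 n, n / (ℓ ^ i * degreeT K ℓ)

/-- Schur's constant `S(n,K)`. The product runs over all primes; almost all of its factors
are `1`: see `finite_mulSupport`. -/
noncomputable def schurConstant (n : ℕ) (K : IntermediateField ℚ ℂ) : ℕ :=
  2 ^ (n - n / degreeT K 2) * ∏ᶠ ℓ : Nat.Primes, (ℓ : ℕ) ^ schurExponent n K ℓ

theorem isPrimitiveRoot_zeta {m : ℕ} (hm : m ≠ 0) : IsPrimitiveRoot (zeta m) m :=
  Complex.isPrimitiveRoot_exp m hm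

theorem finrank_cyclo {m : ℕ} (hm : m ≠ 0) : Module.finrank ℚ (cyclo m) = m.totient := by
  have h := isPrimitiveRoot_zeta hm
  have hpos := Nat.pos_of_ne_zero hm
  rw [cyclo, IntermediateField.adjoin.finrank (h.isIntegral hpos).tower_top,
    ← Polynomial.cyclotomic_eq_minpoly_rat h hpos, Polynomial.natDegree_cyclotomic]

theorem cyclo_mono {a b : ℕ} (hb : b ≠ 0) (h : a ∣ b) : cyclo a ≤ cyclo b := by
  rw [cyclo, IntermediateField.adjoin_simple_le_iff]
  have ha : a ≠ 0 := fun h0 => hb (by simpa [h0] using h)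
  have : NeZero b := ⟨hb⟩
  have h1 : zeta a ^ b = 1 := ((isPrimitiveRoot_zeta ha).pow_eq_one_iff_dvd b).2 h
  obtain ⟨i, -, hi⟩ := (isPrimitiveRoot_zeta hb).eq_pow_of_pow_eq_one h1
  rw [← hi]
  exact pow_mem (IntermediateField.mem_adjoin_simple_self ℚ _) i

theorem stableLevels_nonempty (K : IntermediateField ℚ ℂ) [FiniteDimensional ℚ K]
    {ℓ : ℕ} (hl : ℓ.Prime) : (stableLevels K ℓ).Nonempty := by
  have hmono : ∀ a b, a ≤ b → K ⊓ cyclo (ℓ ^ a) ≤ K ⊓ cyclo (ℓ ^ b) := fun a b hab =>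
    inf_le_inf_left K (cyclo_mono (pow_ne_zero _ hl.ne_zero) (pow_dvd_pow ℓ hab))
  have hfin : ∀ a, FiniteDimensional ℚ ↥(K ⊓ cyclo (ℓ ^ a)) := fun a =>
    Module.Finite.of_injective (IntermediateField.inclusion (inf_le_left :
      K ⊓ cyclo (ℓ ^ a) ≤ K)).toLinearMap (IntermediateField.inclusion_injective inf_le_left)
  have hbd : BddAbove (Set.range fun a => Module.finrank ℚ ↥(K ⊓ cyclo (ℓ ^ a))) := by
    refine ⟨Module.finrank ℚ K, ?_⟩
    rintro _ ⟨a, rfl⟩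
    exact LinearMap.finrank_le_finrank_of_injective (f := (IntermediateField.inclusion
      (inf_le_left : K ⊓ cyclo (ℓ ^ a) ≤ K)).toLinearMap)
      (IntermediateField.inclusion_injective inf_le_left)
  obtain ⟨N, hN⟩ := Nat.sSup_mem (Set.range_nonempty _) hbd
  refine ⟨N + 1, by omega, fun k hk => ?_⟩
  have key : ∀ j, N ≤ j → K ⊓ cyclo (ℓ ^ N) = K ⊓ cyclo (ℓ ^ j) := fun j hj =>
    have := hfin j
    IntermediateField.eq_of_le_of_finrank_le (hmono N j hj)
      (le_trans (le_csSup hbd ⟨j, rfl⟩) hN.ge)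
  rw [← key k (by omega), ← key (N + 1) (by omega)]

theorem levelM_mem (K : IntermediateField ℚ ℂ) [FiniteDimensional ℚ K]
    {ℓ : ℕ} (hl : ℓ.Prime) : levelM K ℓ ∈ stableLevels K ℓ :=
  Nat.sInf_mem (stableLevels_nonempty K hl)

theorem le_degreeT_mul (K : IntermediateField ℚ ℂ) [FiniteDimensional ℚ K]
    {ℓ : ℕ} (hl : ℓ.Prime) : ℓ - 1 ≤ degreeT K ℓ * Module.finrank ℚ K := by
  have hm := (levelM_mem K hl).1
  set m := levelM K ℓ with hmdef
  have h1 : Module.finrank ℚ ↥(K ⊓ cyclo (ℓ ^ m)) * degreeT K ℓ = (ℓ ^ m).totient := by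
    rw [← finrank_cyclo (pow_ne_zero _ hl.ne_zero), degreeT]
    exact IntermediateField.finrank_bot_mul_relfinrank inf_le_right
  have h2 : Module.finrank ℚ ↥(K ⊓ cyclo (ℓ ^ m)) ≤ Module.finrank ℚ K :=
    LinearMap.finrank_le_finrank_of_injective (f := (IntermediateField.inclusion
      (inf_le_left : K ⊓ cyclo (ℓ ^ m) ≤ K)).toLinearMap)
      (IntermediateField.inclusion_injective inf_le_left)
  have h3 : ℓ - 1 ≤ (ℓ ^ m).totient := by
    rw [Nat.totient_prime_pow hl (by omega)]
    exact Nat.le_mul_of_pos_left _ (pow_pos hl.pos _)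
  calc ℓ - 1 ≤ _ := h3
    _ = degreeT K ℓ * Module.finrank ℚ ↥(K ⊓ cyclo (ℓ ^ m)) := by rw [← h1, mul_comm]
    _ ≤ _ := Nat.mul_le_mul_left _ h2

theorem div_eq_zero_of_gt {n i ℓ : ℕ} (t : ℕ) (hl : ℓ.Prime) (hi : n < i) :
    n / (ℓ ^ i * t) = 0 := by
  rcases Nat.eq_zero_or_pos t with rfl | ht
  · simp
  · exact Nat.div_eq_of_lt (hi.trans ((Nat.lt_pow_self hl.one_lt).trans_le
      (Nat.le_mul_of_pos_right _ ht)))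

theorem finite_mulSupport (n : ℕ) (K : IntermediateField ℚ ℂ) [FiniteDimensional ℚ K] :
    (Function.mulSupport fun ℓ : Nat.Primes => (ℓ : ℕ) ^ schurExponent n K ℓ).Finite := by
  refine ((Set.finite_Iic (n * Module.finrank ℚ K + 1)).preimage
    (Subtype.val_injective.injOn (s := _))).subset fun ℓ hℓ => ?_
  by_contra hgt
  simp only [Set.mem_preimage, Set.mem_Iic, not_le] at hgt
  have h1 := le_degreeT_mul K ℓ.2
  have h2 : n < degreeT K ℓ := by
    by_contra h
    have := Nat.mul_le_mul_right (Module.finrank ℚ K) (not_lt.1 h)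
    change n * Module.finrank ℚ K + 1 < (ℓ : ℕ) at hgt
    omega
  apply hℓ
  have h3 : ∀ i ∈ Finset.Icc 1 n, n / ((ℓ : ℕ) ^ i * degreeT K ℓ) = 0 := fun i _ =>
    Nat.div_eq_of_lt (h2.trans_le (Nat.le_mul_of_pos_left _ (pow_pos ℓ.2.pos _)))
  simp [schurExponent, Nat.div_eq_of_lt h2, Finset.sum_eq_zero h3]

end SchurBound

/-! Only a subgroup P of order |G|_ℓ matters. Its eigenvalues are ℓ^e-th roots of unity for large e.
The Galois group of ℚ(ζ_{ℓ^e}) over its intersection with K is cyclic because ℓ is odd; a generator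
acts as ζ ↦ ζ^q, so traces in K satisfy tr(g^q) = tr(g) (`exists_pow_generator`). Hence z ↦ z^q
permutes the eigenvalues of g, and the product of 1 + z + ⋯ + z^(q-1) over them telescopes to
q^c(g), where c(g) is the multiplicity of 1 (`prod_geom_sum_eq`).

Therefore ∏_{i<n} (q^c(g) - q^i) is a symmetric integer polynomial in the eigenvalues, i.e. a
virtual character, and its sum over P is a multiple of |P| (`exists_sum_aeval_eq`). Only g = 1
contributes, so |P| divides ∏_{i<n} (q^n - q^i) (`card_dvd_prod_pow_sub_pow`).

Modulo ℓ^e the order of q is t ℓ^(e-m), with ℓ ∤ t (`not_dvd_degreeT`). This bounds the ℓ-adic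
valuation of each q^i - 1, and the bounds add up to Schur's exponent
(`padicValNat_prod_pow_sub_one_le`). -/

/-! ### Averaging and virtual characters -/

namespace SchurBound

open Matrix

/-- The average of a finite group of matrices. -/
noncomputable def averageMatrix {G ι : Type*} [Group G] [Fintype G] [Fintype ι] [DecidableEq ι]
    (ρ : G →* Matrix ι ι ℂ) : Matrix ι ι ℂ :=
  (Fintype.card G : ℂ)⁻¹ • ∑ g, ρ g

theorem isIdempotentElem_averageMatrix {G ι : Type*} [Group G] [Fintype G] [Fintype ι]
    [DecidableEq ι] (ρ : G →* Matrix ι ι ℂ) : IsIdempotentElem (averageMatrix ρ) := by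
  have hmul : ∀ h, ρ h * ∑ g, ρ g = ∑ g, ρ g := fun h => by
    rw [Finset.mul_sum]
    simp_rw [← map_mul]
    exact Fintype.sum_equiv (Equiv.mulLeft h) _ _ fun _ => rfl
  have hc : (Fintype.card G : ℂ) ≠ 0 := by simp
  rw [IsIdempotentElem, averageMatrix, smul_mul_smul_comm, Finset.sum_mul,
    Finset.sum_congr rfl fun h _ => hmul h, Finset.sum_const, Finset.card_univ,
    ← Nat.cast_smul_eq_nsmul ℂ, smul_smul]
  congr 1
  field_simp

theorem exists_trace_eq_natCast {ι : Type*} [Fintype ι] [DecidableEq ι] {π : Matrix ι ι ℂ}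
    (h : IsIdempotentElem π) : ∃ k : ℕ, π.trace = k := by
  have h' : IsIdempotentElem (Matrix.toLin' π) := by
    rw [IsIdempotentElem, Module.End.mul_eq_comp, ← Matrix.toLin'_mul, h.eq]
  obtain ⟨p, hp⟩ := LinearMap.isProj_iff_isIdempotentElem _ |>.2 h'
  exact ⟨_, by rw [← Matrix.trace_toLin'_eq, hp.trace]⟩

/-- The functions `g ↦ trace (π * ρ g)` for a matrix representation `ρ` and an idempotent `π`
that commutes with it: the characters of the representations on the images of such `π`. -/
def IsProjTrace {G : Type*} [Group G] (f : G → ℂ) : Prop :=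
  ∃ (ι : Type) (_ : Fintype ι) (_ : DecidableEq ι) (ρ : G →* Matrix ι ι ℂ) (π : Matrix ι ι ℂ),
    IsIdempotentElem π ∧ (∀ g, Commute π (ρ g)) ∧ ∀ g, f g = (π * ρ g).trace

theorem IsProjTrace.one {G : Type*} [Group G] : IsProjTrace (1 : G → ℂ) :=
  ⟨Unit, inferInstance, inferInstance, 1, 1, IsIdempotentElem.one, fun _ => Commute.one_left _,
    fun g => by simp⟩

theorem IsProjTrace.mul {G : Type*} [Group G] {f₁ f₂ : G → ℂ} (h₁ : IsProjTrace f₁)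
    (h₂ : IsProjTrace f₂) : IsProjTrace (f₁ * f₂) := by
  obtain ⟨ι₁, _, _, ρ₁, π₁, i₁, c₁, e₁⟩ := h₁
  obtain ⟨ι₂, _, _, ρ₂, π₂, i₂, c₂, e₂⟩ := h₂
  refine ⟨ι₁ × ι₂, inferInstance, inferInstance,
    { toFun := fun g => kroneckerMap (· * ·) (ρ₁ g) (ρ₂ g)
      map_one' := by simp
      map_mul' := fun g h => by simp [mul_kronecker_mul] },
    kroneckerMap (· * ·) π₁ π₂, ?_, fun g => ?_, fun g => ?_⟩
  · rw [IsIdempotentElem, ← mul_kronecker_mul, i₁.eq, i₂.eq]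
  · simp only [Commute, SemiconjBy, MonoidHom.coe_mk, OneHom.coe_mk, ← mul_kronecker_mul,
      (c₁ g).eq, (c₂ g).eq]
  · simp only [MonoidHom.coe_mk, OneHom.coe_mk, ← mul_kronecker_mul, trace_kronecker, e₁, e₂,
      Pi.mul_apply]

/-- The projection π commutes with the average of ρ, so their product is idempotent and its trace is
a rank. -/
theorem IsProjTrace.exists_sum_eq {G : Type*} [Group G] [Fintype G] {f : G → ℂ}
    (h : IsProjTrace f) : ∃ z : ℤ, ∑ g, f g = Fintype.card G * z := by
  obtain ⟨ι, _, _, ρ, π, i, c, e⟩ := h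
  have hcomm : Commute π (averageMatrix ρ) :=
    (Commute.sum_right _ _ _ fun g _ => c g).smul_right _
  obtain ⟨k, hk⟩ := exists_trace_eq_natCast
    (i.mul_of_commute hcomm (isIdempotentElem_averageMatrix ρ))
  refine ⟨k, ?_⟩
  rw [Int.cast_natCast, ← hk, averageMatrix, mul_smul_comm, trace_smul, Finset.mul_sum, trace_sum,
    smul_eq_mul, mul_inv_cancel_left₀ (by simp)]
  exact Finset.sum_congr rfl fun g _ => e g

/-- The ring of virtual characters, spanned by the traces `IsProjTrace`. -/
def virtualCharacter (G : Type*) [Group G] : Subring (G → ℂ) := Subring.closure {f | IsProjTrace f}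

theorem exists_sum_eq_of_mem_virtualCharacter {G : Type*} [Group G] [Fintype G] {f : G → ℂ}
    (h : f ∈ virtualCharacter G) : ∃ z : ℤ, ∑ g, f g = Fintype.card G * z := by
  let S : Submonoid (G → ℂ) :=
    { carrier := {f | IsProjTrace f}
      one_mem' := IsProjTrace.one
      mul_mem' := IsProjTrace.mul }
  -- The generators form a monoid, so the ring they generate is their additive span and linearity
  -- finishes.
  replace h : f ∈ AddSubgroup.closure (S : Set (G → ℂ)) := by
    rw [virtualCharacter, Subring.mem_closure_iff] at h
    rwa [← Submonoid.closure_eq S]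
  induction h using AddSubgroup.closure_induction with
  | mem x hx => exact IsProjTrace.exists_sum_eq hx
  | zero => exact ⟨0, by simp⟩
  | add x y _ _ hx hy =>
    obtain ⟨⟨a, ha⟩, ⟨b, hb⟩⟩ := And.intro hx hy
    exact ⟨a + b, by simp [Finset.sum_add_distrib, ha, hb, mul_add]⟩
  | neg x _ hx =>
    obtain ⟨a, ha⟩ := hx
    exact ⟨-a, by simp [ha]⟩

end SchurBound

/-! ### Exterior powers and symmetric functions of eigenvalues -/

namespace SchurBound

open Matrix

/-- The `k`-th tensor power of a matrix, as a monoid homomorphism. -/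
def tensorPow (n k : ℕ) :
    Matrix (Fin n) (Fin n) ℂ →* Matrix (Fin k → Fin n) (Fin k → Fin n) ℂ where
  toFun A := Matrix.of fun a b => ∏ i, A (a i) (b i)
  map_one' := by
    ext a b
    simp only [of_apply, one_apply, Finset.prod_ite_zero, Finset.prod_const_one, funext_iff,
      Finset.mem_univ, true_imp_iff]
  map_mul' A B := by
    ext a b
    simp only [of_apply, mul_apply, Finset.prod_univ_sum, Fintype.piFinset_univ,
      Finset.prod_mul_distrib]

theorem tensorPow_apply {n k : ℕ} (A : Matrix (Fin n) (Fin n) ℂ) (a b : Fin k → Fin n) :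
    tensorPow n k A a b = ∏ i, A (a i) (b i) := rfl

/-- The action of permutations on a tensor power, twisted by the sign. -/
def signTensorPerm (n k : ℕ) :
    Equiv.Perm (Fin k) →* Matrix (Fin k → Fin n) (Fin k → Fin n) ℂ where
  toFun σ := Matrix.of fun a b => if b = a ∘ σ then ((σ.sign : ℤ) : ℂ) else 0
  map_one' := by
    ext a b
    simp [one_apply, eq_comm]
  map_mul' σ τ := by
    ext a b
    rw [mul_apply, Finset.sum_eq_single (a ∘ σ) (fun c _ hc => by simp [hc]) (by simp)]
    simp [Function.comp_assoc]

theorem signTensorPerm_apply {n k : ℕ} (σ : Equiv.Perm (Fin k)) (a b : Fin k → Fin n) :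
    signTensorPerm n k σ a b = if b = a ∘ σ then ((σ.sign : ℤ) : ℂ) else 0 := rfl

theorem commute_signTensorPerm_tensorPow {n k : ℕ} (σ : Equiv.Perm (Fin k))
    (A : Matrix (Fin n) (Fin n) ℂ) : Commute (signTensorPerm n k σ) (tensorPow n k A) := by
  ext a b
  have h : ∀ c : Fin k → Fin n, b = c ∘ σ ↔ c = b ∘ σ.symm := fun c =>
    ⟨by rintro rfl; ext; simp, by rintro rfl; simp [Function.comp_assoc]⟩
  simp only [mul_apply, signTensorPerm_apply, tensorPow_apply, ite_mul, zero_mul, mul_ite,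
    mul_zero, h, Finset.sum_ite_eq', Finset.mem_univ, if_true, Function.comp_apply]
  rw [mul_comm]
  congr 1
  exact Fintype.prod_equiv σ _ _ fun i => by simp

/-- The projection of a tensor power onto the alternating tensors. -/
noncomputable def antisymmetrizer (n k : ℕ) : Matrix (Fin k → Fin n) (Fin k → Fin n) ℂ :=
  averageMatrix (signTensorPerm n k)

theorem commute_antisymmetrizer_tensorPow {n k : ℕ} (A : Matrix (Fin n) (Fin n) ℂ) :
    Commute (antisymmetrizer n k) (tensorPow n k A) :=
  (Commute.sum_left _ _ _ fun σ _ => commute_signTensorPerm_tensorPow σ A).smul_left _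

/-- The sum is the Leibniz expansion of the determinant of the matrix with entries [a i = a j]: the
identity if a is injective, and with two equal rows otherwise. -/
theorem sum_sign_ite_comp_eq {n k : ℕ} (a : Fin k → Fin n) :
    ∑ σ : Equiv.Perm (Fin k), (if a = a ∘ σ then ((σ.sign : ℤ) : ℂ) else 0) =
      if Function.Injective a then 1 else 0 := by
  have h : ∑ σ : Equiv.Perm (Fin k), (if a = a ∘ σ then ((σ.sign : ℤ) : ℂ) else 0) =
      (Matrix.of fun i j => if a i = a j then (1 : ℂ) else 0).det := by
    rw [det_apply']
    refine Finset.sum_congr rfl fun σ _ => ?_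
    simp only [of_apply, Finset.prod_ite_zero, Finset.prod_const_one, Finset.mem_univ,
      true_imp_iff, mul_ite, mul_one, mul_zero, funext_iff, Function.comp_apply, eq_comm]
  rw [h]
  split_ifs with ha
  · convert det_one (n := Fin k) (R := ℂ)
    ext i j
    simp [one_apply, ha.eq_iff]
  · simp only [Function.Injective, not_forall] at ha
    obtain ⟨i, j, hij, hne⟩ := ha
    exact det_zero_of_row_eq hne (by ext l; simp [hij])

/-- Each k-subset is the image of exactly k! injections. -/
theorem sum_prod_injective {R : Type*} [CommRing R] {n k : ℕ} (d : Fin n → R) :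
    ∑ a : Fin k → Fin n, (if Function.Injective a then ∏ i, d (a i) else 0) =
      k.factorial * ∑ s ∈ Finset.powersetCard k Finset.univ, ∏ i ∈ s, d i := by
  classical
  rw [← Finset.sum_filter, Finset.mul_sum,
    ← Finset.sum_fiberwise_of_maps_to (g := fun a => Finset.univ.image a)
      (t := Finset.powersetCard k Finset.univ)]
  · refine Finset.sum_congr rfl fun s hs => ?_
    rw [Finset.mem_powersetCard_univ] at hs
    have hval : ∀ a ∈ (Finset.univ.filter fun a : Fin k → Fin n => Function.Injective a).filter
        (fun a => Finset.univ.image a = s), ∏ i, d (a i) = ∏ i ∈ s, d i := by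
      intro a ha
      simp only [Finset.mem_filter, Finset.mem_univ, true_and] at ha
      rw [← ha.2, Finset.prod_image ha.1.injOn]
    rw [Finset.sum_congr rfl hval, Finset.sum_const, nsmul_eq_mul]
    congr 2
    have hcard : Fintype.card (Fin k ≃ s) = k.factorial := by
      rw [Fintype.card_equiv (Fintype.equivFinOfCardEq (by simpa using hs)).symm, Fintype.card_fin]
    rw [← hcard, ← Finset.card_univ]
    symm
    refine Finset.card_bij (fun e _ i => (e i : Fin n)) ?_ ?_ ?_
    · intro e _
      simp only [Finset.mem_filter, Finset.mem_univ, true_and]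
      refine ⟨Subtype.val_injective.comp e.injective, ?_⟩
      ext x
      simp only [Finset.mem_image, Finset.mem_univ, true_and]
      exact ⟨by rintro ⟨i, rfl⟩; exact (e i).2, fun hx => ⟨e.symm ⟨x, hx⟩, by simp⟩⟩
    · intro e _ e' _ h
      ext i
      exact congrArg Fin.val (congrFun h i)
    · intro a ha
      simp only [Finset.mem_filter, Finset.mem_univ, true_and] at ha
      obtain ⟨ha, rfl⟩ := ha
      refine ⟨Equiv.ofBijective (fun i => ⟨a i, Finset.mem_image_of_mem a (Finset.mem_univ i)⟩)
        ⟨fun i j h => ha (congrArg Subtype.val h), ?_⟩, Finset.mem_univ _, rfl⟩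
      rintro ⟨x, hx⟩
      obtain ⟨i, -, hi⟩ := Finset.mem_image.1 hx
      exact ⟨i, Subtype.ext hi⟩
  · intro a ha
    simp only [Finset.mem_filter, Finset.mem_univ, true_and] at ha
    rw [Finset.mem_powersetCard_univ, Finset.card_image_of_injective _ ha, Finset.card_fin]

theorem trace_antisymmetrizer_mul_diagonal {n k : ℕ} (d : Fin n → ℂ) :
    (antisymmetrizer n k * tensorPow n k (diagonal d)).trace =
      ∑ s ∈ Finset.powersetCard k Finset.univ, ∏ i ∈ s, d i := by
  have hdiag : tensorPow n k (diagonal d) = diagonal fun a => ∏ i, d (a i) := by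
    ext a b
    simp only [tensorPow_apply, diagonal_apply, Finset.prod_ite_zero, Finset.mem_univ,
      true_imp_iff, funext_iff]
  have hf : (k.factorial : ℂ) ≠ 0 := by exact_mod_cast k.factorial_ne_zero
  rw [hdiag, trace]
  simp only [diag_apply, mul_diagonal, antisymmetrizer, averageMatrix, Matrix.smul_apply, Matrix.sum_apply,
    signTensorPerm_apply, sum_sign_ite_comp_eq, smul_eq_mul, Fintype.card_perm, Fintype.card_fin,
    mul_assoc, ite_mul, one_mul, zero_mul]
  rw [← Finset.mul_sum, sum_prod_injective, inv_mul_cancel_left₀ hf]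

/-- `d` is the family of eigenvalues of the diagonalizable matrix `A`. -/
def IsDiagonalization {n : ℕ} (A : Matrix (Fin n) (Fin n) ℂ) (d : Fin n → ℂ) : Prop :=
  ∃ S : (Matrix (Fin n) (Fin n) ℂ)ˣ, A = S * diagonal d * (S⁻¹ : (Matrix (Fin n) (Fin n) ℂ)ˣ)

theorem trace_antisymmetrizer_mul_tensorPow {n k : ℕ} {A : Matrix (Fin n) (Fin n) ℂ}
    {d : Fin n → ℂ} (h : IsDiagonalization A d) :
    (antisymmetrizer n k * tensorPow n k A).trace =
      ∑ s ∈ Finset.powersetCard k Finset.univ, ∏ i ∈ s, d i := by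
  obtain ⟨S, rfl⟩ := h
  rw [← trace_antisymmetrizer_mul_diagonal, map_mul, map_mul, mul_assoc, ← mul_assoc,
    (commute_antisymmetrizer_tensorPow _).eq, mul_assoc, trace_mul_comm, mul_assoc, mul_assoc,
    ← map_mul, Units.inv_mul, map_one, mul_one]

/-- Symmetric polynomials are integer polynomials in the elementary ones, whose values at the
eigenvalues are the characters of the exterior powers. -/
theorem exists_sum_aeval_eq {G : Type*} [Group G] [Fintype G] {n : ℕ}
    (ρ : G →* Matrix (Fin n) (Fin n) ℂ) {d : G → Fin n → ℂ}
    (hd : ∀ g, IsDiagonalization (ρ g) (d g)) {F : MvPolynomial (Fin n) ℤ} (hF : F.IsSymmetric) :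
    ∃ z : ℤ, ∑ g, MvPolynomial.aeval (d g) F = Fintype.card G * (z : ℂ) := by
  refine exists_sum_eq_of_mem_virtualCharacter (f := fun g => MvPolynomial.aeval (d g) F) ?_
  obtain ⟨p, hp⟩ := MvPolynomial.esymmAlgHom_surjective (σ := Fin n) (R := ℤ) (n := n) (by simp)
    ⟨F, hF⟩
  replace hp := congrArg Subtype.val hp
  rw [MvPolynomial.esymmAlgHom_apply] at hp
  have hgen : ∀ i : Fin n, (fun g => MvPolynomial.aeval (d g)
      (MvPolynomial.esymm (Fin n) ℤ (i + 1))) ∈ virtualCharacter G := by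
    intro i
    refine Subring.subset_closure ⟨Fin (i + 1) → Fin n, inferInstance, inferInstance,
      (tensorPow n (i + 1)).comp ρ, antisymmetrizer n (i + 1),
      isIdempotentElem_averageMatrix _, fun g => commute_antisymmetrizer_tensorPow _, fun g => ?_⟩
    rw [MonoidHom.comp_apply, trace_antisymmetrizer_mul_tensorPow (hd g)]
    simp [MvPolynomial.esymm]
  subst hp
  clear hF
  induction p using MvPolynomial.induction_on with
  | C a =>
    simp only [map_intCast, eq_intCast]
    exact intCast_mem (virtualCharacter G) a
  | add p q hp hq =>
    simp only [map_add]
    exact add_mem hp hq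
  | mul_X p i hp =>
    simp only [map_mul, MvPolynomial.aeval_X]
    exact mul_mem hp (hgen i)

end SchurBound

/-! ### Power-invariant characters and the divisibility of the group order -/

namespace SchurBound

open Matrix

theorem IsDiagonalization.pow {n : ℕ} {A : Matrix (Fin n) (Fin n) ℂ} {d : Fin n → ℂ}
    (h : IsDiagonalization A d) (k : ℕ) : IsDiagonalization (A ^ k) (d ^ k) := by
  obtain ⟨S, rfl⟩ := h
  exact ⟨S, by rw [← diagonal_pow, Units.conj_pow]⟩

theorem IsDiagonalization.trace_eq {n : ℕ} {A : Matrix (Fin n) (Fin n) ℂ} {d : Fin n → ℂ}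
    (h : IsDiagonalization A d) : A.trace = ∑ i, d i := by
  obtain ⟨S, rfl⟩ := h
  rw [trace_units_conj, trace_diagonal]

theorem IsDiagonalization.eq_one_iff {n : ℕ} {A : Matrix (Fin n) (Fin n) ℂ} {d : Fin n → ℂ}
    (h : IsDiagonalization A d) : A = 1 ↔ d = 1 := by
  obtain ⟨S, rfl⟩ := h
  rw [Units.mul_inv_eq_one]
  nth_rw 2 [← mul_one (S : Matrix (Fin n) (Fin n) ℂ)]
  rw [Units.mul_right_inj, diagonal_eq_one]

/-- `X ^ N - 1` is separable, so A is semisimple and its eigenvectors span; a basis is extracted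
from them. -/
theorem exists_isDiagonalization {n N : ℕ} (hN : N ≠ 0) {A : Matrix (Fin n) (Fin n) ℂ}
    (hA : A ^ N = 1) : ∃ d, IsDiagonalization A d := by
  have hss : Module.End.IsSemisimple (toLin' A) := by
    refine Module.End.isSemisimple_of_squarefree_aeval_eq_zero
      (p := Polynomial.X ^ N - 1) ?_ ?_
    · exact (Polynomial.X_pow_sub_one_separable_iff.2 (by exact_mod_cast hN)).squarefree
    · rw [map_sub, map_pow, Polynomial.aeval_X, map_one, ← toLin'_pow, hA, toLin'_one]
      exact sub_self _
  have hspan : ⊤ ≤ Submodule.span ℂ {v : Fin n → ℂ | ∃ μ : ℂ, toLin' A v = μ • v} := by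
    rw [← hss.iSup_eigenspace_eq_top, iSup_le_iff]
    exact fun μ v hv => Submodule.subset_span ⟨μ, Module.End.mem_eigenspace_iff.1 hv⟩
  let b := Module.Basis.ofSpan hspan
  have hfin := Module.Finite.finite_basis b
  have := Fintype.ofFinite ((linearIndepOn_empty ℂ id).extend
    (Set.empty_subset {v : Fin n → ℂ | ∃ μ : ℂ, toLin' A v = μ • v}))
  let e := Fintype.equivFinOfCardEq (by
    rw [← Module.finrank_eq_card_basis b, Module.finrank_fin_fun] :
      Fintype.card ((linearIndepOn_empty ℂ id).extend
        (Set.empty_subset {v : Fin n → ℂ | ∃ μ : ℂ, toLin' A v = μ • v})) = n)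
  let c := b.reindex e
  have hc : ∀ i, ∃ μ : ℂ, toLin' A (c i) = μ • c i := fun i => by
    have : c i ∈ Set.range b := ⟨e.symm i, (b.reindex_apply e i).symm⟩
    exact Module.Basis.ofSpan_subset hspan this
  choose d hd using hc
  have := (Pi.basisFun ℂ (Fin n)).invertibleToMatrix c
  let S := unitOfInvertible ((Pi.basisFun ℂ (Fin n)).toMatrix c)
  refine ⟨d, S, ?_⟩
  rw [Units.eq_mul_inv_iff_mul_eq]
  ext i j
  have h1 := congrFun (hd j) i
  simp only [toLin'_apply, mulVec, dotProduct, Pi.smul_apply, smul_eq_mul] at h1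
  rw [mul_diagonal, mul_apply]
  simp only [S, val_unitOfInvertible, Module.Basis.toMatrix_apply,
    Pi.basisFun_repr]
  rw [h1, mul_comm]

theorem sum_pow_of_pow_eq_one {N : ℕ} {z : ℂ} (hz : z ^ N = 1) :
    ∑ k ∈ Finset.range N, z ^ k = if z = 1 then (N : ℂ) else 0 := by
  split_ifs with h
  · simp [h]
  · rw [geom_sum_eq h, hz, sub_self, zero_div]

/-- Fourier inversion on N-th roots of unity: power sums determine the multiplicity of each μ. -/
theorem map_eq_map_of_sum_pow_eq {n N : ℕ} (hN : N ≠ 0) {d d' : Fin n → ℂ}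
    (hd : ∀ i, d i ^ N = 1) (hd' : ∀ i, d' i ^ N = 1)
    (h : ∀ k, ∑ i, d i ^ k = ∑ i, d' i ^ k) :
    (Finset.univ.val.map d : Multiset ℂ) = Finset.univ.val.map d' := by
  classical
  have hcount : ∀ f : Fin n → ℂ, (∀ i, f i ^ N = 1) → ∀ μ : ℂ, μ ^ N = 1 →
      (N : ℂ) * (Finset.univ.val.map f).count μ =
        ∑ k ∈ Finset.range N, μ⁻¹ ^ k * ∑ i, f i ^ k := by
    intro f hf μ hμ
    have hμ0 : μ ≠ 0 := by rintro rfl; simp [hN] at hμ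
    simp_rw [Finset.mul_sum, ← mul_pow]
    rw [Finset.sum_comm, Finset.sum_congr rfl fun i _ =>
      sum_pow_of_pow_eq_one (z := μ⁻¹ * f i) (by rw [mul_pow, hf, inv_pow, hμ]; simp)]
    simp_rw [inv_mul_eq_one₀ hμ0]
    rw [← Finset.sum_filter, Finset.sum_const, nsmul_eq_mul, mul_comm, Multiset.count_map]
    rfl
  ext μ
  by_cases hμ : μ ^ N = 1
  · have h1 := hcount d hd μ hμ
    simp_rw [h] at h1
    rw [← hcount d' hd' μ hμ] at h1
    exact_mod_cast mul_left_cancel₀ (by exact_mod_cast hN) h1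
  · rw [Multiset.count_eq_zero_of_notMem, Multiset.count_eq_zero_of_notMem]
    · rintro hmem
      obtain ⟨i, -, rfl⟩ := Multiset.mem_map.1 hmem
      exact hμ (hd' i)
    · rintro hmem
      obtain ⟨i, -, rfl⟩ := Multiset.mem_map.1 hmem
      exact hμ (hd i)

theorem prod_geom_sum_eq {n q : ℕ} {d : Fin n → ℂ} (h1 : ∀ i, d i ^ q = 1 → d i = 1)
    (h : (Finset.univ.val.map d : Multiset ℂ) = Finset.univ.val.map (d ^ q)) :
    ∏ i, ∑ j ∈ Finset.range q, d i ^ j = (q : ℂ) ^ (Finset.univ.filter fun i => d i = 1).card := by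
  -- Replacing z - 1 by 1 at z = 1 makes the product nonzero, so it can be cancelled; each z ≠ 1
  -- contributes (z^q - 1)/(z - 1), each z = 1 contributes q.
  let u : ℂ → ℂ := fun z => if z = 1 then 1 else z - 1
  have hu : ∏ i, u (d i) = ∏ i, u (d i ^ q) := by
    have := congrArg (fun s => (Multiset.map u s).prod) h
    rwa [Multiset.map_map, Multiset.map_map] at this
  have hu0 : ∏ i, u (d i) ≠ 0 := Finset.prod_ne_zero_iff.2 fun i _ => by
    simp only [u]
    split_ifs with hi
    · exact one_ne_zero
    · exact sub_ne_zero.2 hi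
  apply mul_right_cancel₀ hu0
  rw [← Finset.prod_const, Finset.prod_filter]
  nth_rw 2 [hu]
  rw [← Finset.prod_mul_distrib, ← Finset.prod_mul_distrib]
  refine Finset.prod_congr rfl fun i _ => ?_
  by_cases hi : d i = 1
  · simp [hi, u]
  · have hi' : d i ^ q ≠ 1 := fun h => hi (h1 i h)
    simp [hi, hi', u, geom_sum_mul]

/-- If the character of a faithful representation of degree `n` is invariant under `g ↦ g ^ q`, then
`g ↦ q ^ dim ker (ρ g - 1)` is a virtual character and the order of the group divides
the product of the `q ^ n - q ^ i`. -/
theorem card_dvd_prod_pow_sub_pow {G : Type*} [Group G] [Fintype G] {n q : ℕ}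
    (ρ : G →* Matrix (Fin n) (Fin n) ℂ) (hρ : Function.Injective ρ)
    (hq : q.Coprime (Fintype.card G)) (htr : ∀ g, (ρ (g ^ q)).trace = (ρ g).trace) :
    (Fintype.card G : ℤ) ∣ ∏ i ∈ Finset.range n, ((q : ℤ) ^ n - (q : ℤ) ^ i) := by
  have hN : Fintype.card G ≠ 0 := Fintype.card_ne_zero
  have hpow : ∀ g, ρ g ^ Fintype.card G = 1 := fun g => by
    rw [← map_pow, pow_card_eq_one, map_one]
  choose d hd using fun g => exists_isDiagonalization hN (hpow g)
  have hroot : ∀ g i, d g i ^ Fintype.card G = 1 := fun g i =>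
    congrFun (((hd g).pow _).eq_one_iff.1 (hpow g)) i
  let c : G → ℕ := fun g => (Finset.univ.filter fun i => d g i = 1).card
  have htheta : ∀ g, ∏ i, ∑ j ∈ Finset.range q, d g i ^ j = (q : ℂ) ^ c g := by
    intro g
    refine prod_geom_sum_eq (fun i hi => ?_) (map_eq_map_of_sum_pow_eq hN (hroot g) (fun i => ?_)
      fun k => ?_)
    · have := pow_gcd_eq_one.2 ⟨hi, hroot g i⟩
      rwa [hq, pow_one] at this
    · rw [Pi.pow_apply, pow_right_comm, hroot, one_pow]
    · have h1 := ((hd g).pow k).trace_eq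
      have h2 := (((hd g).pow q).pow k).trace_eq
      rw [← map_pow] at h1
      rw [pow_right_comm, ← map_pow, ← map_pow, htr, h1] at h2
      exact h2
  -- Its value at g vanishes as soon as c g < n, which by faithfulness holds for every g ≠ 1.
  let F : MvPolynomial (Fin n) ℤ := ∏ i ∈ Finset.range n,
    (∏ j, ∑ k ∈ Finset.range q, MvPolynomial.X j ^ k - MvPolynomial.C ((q : ℤ) ^ i))
  have hF : F.IsSymmetric := fun e => by
    simp only [F, map_prod, map_sub, map_sum, map_pow, MvPolynomial.rename_X, MvPolynomial.rename_C]
    refine Finset.prod_congr rfl fun i _ => ?_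
    congr 1
    exact Fintype.prod_equiv e _ _ fun j => rfl
  have hval : ∀ g, MvPolynomial.aeval (d g) F =
      ∏ i ∈ Finset.range n, ((q : ℂ) ^ c g - (q : ℂ) ^ i) := fun g => by
    simp only [F, map_prod, map_sub, map_sum, map_pow, MvPolynomial.aeval_X, htheta g,
      map_natCast]
  obtain ⟨z, hz⟩ := exists_sum_aeval_eq ρ hd hF
  rw [Finset.sum_eq_single 1 (fun g _ hg => ?_) (by simp), hval] at hz
  · have h1 : c 1 = n := by
      have : d 1 = 1 := (hd 1).eq_one_iff.1 (map_one ρ)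
      simp [c, this]
    rw [h1] at hz
    exact ⟨z, by exact_mod_cast hz⟩
  · have hlt : c g < n := by
      by_contra hge
      have h2 : Finset.univ.filter (fun i => d g i = 1) = Finset.univ :=
        Finset.eq_univ_of_card _ (le_antisymm (Finset.card_le_univ _) (by
          rw [Fintype.card_fin]; exact not_lt.1 hge))
      refine hg (hρ ?_)
      rw [map_one, (hd g).eq_one_iff]
      ext i
      simpa using (Finset.filter_eq_self.1 h2) i (Finset.mem_univ i)
    rw [hval]
    exact Finset.prod_eq_zero (Finset.mem_range.2 hlt) (sub_self _)

end SchurBound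

/-! ### Galois theory of cyclotomic fields of odd prime power level -/

namespace SchurBound

open IntermediateField

/-- In a cyclic group g^|B| = 1 has at most |B| solutions, so B consists of all of them. -/
theorem le_of_card_dvd_card {G : Type*} [Group G] [Finite G] [IsCyclic G] {A B : Subgroup G}
    (h : Nat.card A ∣ Nat.card B) : A ≤ B := by
  classical
  have := Fintype.ofFinite G
  have hle : (Finset.univ.filter fun g : G => g ^ Nat.card B = 1).card ≤ Nat.card B :=
    IsCyclic.card_pow_eq_one_le Nat.card_pos
  have hsub : (Finset.univ.filter fun g : G => g ∈ B) ⊆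
      Finset.univ.filter fun g : G => g ^ Nat.card B = 1 := fun g hg => by
    simp only [Finset.mem_filter, Finset.mem_univ, true_and] at hg ⊢
    exact congrArg Subtype.val (pow_card_eq_one' (x := (⟨g, hg⟩ : B)))
  have hcard : (Finset.univ.filter fun g : G => g ∈ B).card = Nat.card B := by
    rw [Nat.card_eq_fintype_card, Fintype.card_subtype]
  have heq := Finset.eq_of_subset_of_card_le hsub (by rwa [hcard])
  intro a ha
  have : a ∈ Finset.univ.filter fun g : G => g ^ Nat.card B = 1 := by
    simp only [Finset.mem_filter, Finset.mem_univ, true_and]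
    obtain ⟨c, hc⟩ := h
    have h1 : a ^ Nat.card A = 1 := congrArg Subtype.val (pow_card_eq_one' (x := (⟨a, ha⟩ : A)))
    rw [hc, pow_mul, h1, one_pow]
  rw [← heq] at this
  simpa using this

section CyclotomicSubfield

variable {k Ω : Type*} [Field k] [Field Ω] [Algebra k Ω] {N : ℕ} [NeZero N] {ζ : Ω}

theorem isCyclotomicExtension_adjoin (hζ : IsPrimitiveRoot ζ N) :
    IsCyclotomicExtension {N} k k⟮ζ⟯ := by
  change IsCyclotomicExtension {N} k k⟮ζ⟯.toSubalgebra
  rw [adjoin_simple_toSubalgebra_of_isAlgebraic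
    (hζ.isIntegral (NeZero.pos N)).tower_top.isAlgebraic]
  exact hζ.adjoin_isCyclotomicExtension k

theorem card_fixingSubgroup_comap_mul_finrank (K L : IntermediateField k Ω) [FiniteDimensional k L]
    [IsGalois k L] :
    Nat.card (K.comap L.val).fixingSubgroup * Module.finrank k ↥(K ⊓ L) = Module.finrank k L := by
  have h : (K.comap L.val).map L.val = K ⊓ L := by rw [map_comap_eq, fieldRange_val]
  rw [IsGalois.card_fixingSubgroup_eq_finrank, ← h,
    ← (equivMap (K.comap L.val) L.val).toLinearEquiv.finrank_eq, mul_comm,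
    Module.finrank_mul_finrank]

/-- By the Galois correspondence, subfields of a cyclic extension are ordered by divisibility of
degrees. -/
theorem inf_le_of_finrank_dvd_finrank {K L M : IntermediateField k Ω} [FiniteDimensional k L]
    [IsGalois k L] [IsCyclic Gal(L/k)]
    (h : Module.finrank k ↥(M ⊓ L) ∣ Module.finrank k ↥(K ⊓ L)) : M ⊓ L ≤ K := by
  have hK := card_fixingSubgroup_comap_mul_finrank K L
  have hM := card_fixingSubgroup_comap_mul_finrank M L
  have hpos : 0 < Module.finrank k L := Module.finrank_pos
  have hdvd : Nat.card (K.comap L.val).fixingSubgroup ∣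
      Nat.card (M.comap L.val).fixingSubgroup := by
    obtain ⟨c, hc⟩ := h
    refine ⟨c, Nat.eq_of_mul_eq_mul_right (Nat.pos_of_ne_zero fun h0 => ?_) (hM.trans ?_)⟩
    · rw [h0, mul_zero] at hM
      exact hpos.ne hM
    · rw [← hK, hc]
      ring
  have hfix := le_of_card_dvd_card hdvd
  rw [← le_iff_le, IsGalois.fixedField_fixingSubgroup] at hfix
  exact fun x hx => hfix (show (⟨x, hx.2⟩ : L) ∈ M.comap L.val from hx.1)

theorem isCyclic_gal_adjoin [IsCyclic (ZMod N)ˣ] (hζ : IsPrimitiveRoot ζ N) :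
    IsCyclic Gal(k⟮ζ⟯/k) := by
  have := isCyclotomicExtension_adjoin (k := k) hζ
  exact isCyclic_of_injective _ (IsPrimitiveRoot.autToPow_injective (K := k)
    (IsCyclotomicExtension.zeta_spec N k k⟮ζ⟯))

theorem inf_adjoin_le_of_finrank_dvd_finrank [CharZero k] [IsCyclic (ZMod N)ˣ]
    (hζ : IsPrimitiveRoot ζ N) {K M : IntermediateField k Ω}
    (h : Module.finrank k ↥(M ⊓ k⟮ζ⟯) ∣ Module.finrank k ↥(K ⊓ k⟮ζ⟯)) : M ⊓ k⟮ζ⟯ ≤ K := by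
  have := isCyclotomicExtension_adjoin (k := k) hζ
  have := IsCyclotomicExtension.finiteDimensional {N} k k⟮ζ⟯
  have := IsCyclotomicExtension.isGalois {N} k k⟮ζ⟯
  have := isCyclic_gal_adjoin (k := k) hζ
  exact inf_le_of_finrank_dvd_finrank h

/-- A generator of the Galois group of a cyclotomic field over its intersection with `K`, written
as a power map. -/
theorem exists_pow_generator_adjoin [CharZero k] [IsCyclic (ZMod N)ˣ]
    (hζ : IsPrimitiveRoot ζ N) (K : IntermediateField k Ω) :
    ∃ q : ℕ, q.Coprime N ∧
      orderOf (q : ZMod N) * Module.finrank k ↥(K ⊓ k⟮ζ⟯) = Module.finrank k k⟮ζ⟯ ∧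
      ∀ {n : ℕ} (d : Fin n → Ω), (∀ i, d i ^ N = 1) → ∑ i, d i ∈ K →
        ∑ i, d i ^ q = ∑ i, d i := by
  have := isCyclotomicExtension_adjoin (k := k) hζ
  have := IsCyclotomicExtension.finiteDimensional {N} k k⟮ζ⟯
  have := IsCyclotomicExtension.isGalois {N} k k⟮ζ⟯
  have := isCyclic_gal_adjoin (k := k) hζ
  have hz := IsCyclotomicExtension.zeta_spec N k k⟮ζ⟯
  -- The exponent q is read off from a generator σ of the group fixing K ∩ k(ζ); its order is the
  -- order of that group.
  obtain ⟨σ, hσ⟩ := IsCyclic.exists_ofOrder_eq_natCard (α := (K.comap k⟮ζ⟯.val).fixingSubgroup)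
  let u := hz.autToPow k (σ : Gal(k⟮ζ⟯/k))
  refine ⟨u.val.val, ZMod.val_coe_unit_coprime u, ?_, fun d hd hK => ?_⟩
  · rw [ZMod.natCast_zmod_val, orderOf_units,
      orderOf_injective _ (IsPrimitiveRoot.autToPow_injective (K := k) hz), Subgroup.orderOf_coe,
      hσ, card_fixingSubgroup_comap_mul_finrank]
  · have hmem : ∀ i, d i ∈ k⟮ζ⟯ := fun i => by
      obtain ⟨j, -, hj⟩ := hζ.eq_pow_of_pow_eq_one (hd i)
      rw [← hj]
      exact pow_mem (mem_adjoin_simple_self k _) j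
    let d' := fun i => (⟨d i, hmem i⟩ : k⟮ζ⟯)
    have hfix : (σ : Gal(k⟮ζ⟯/k)) (∑ i, d' i) = ∑ i, d' i := by
      refine (mem_fixingSubgroup_iff _ _).1 σ.2 _ ?_
      change k⟮ζ⟯.val (∑ i, d' i) ∈ K
      rw [map_sum]
      exact hK
    rw [map_sum] at hfix
    have hpow : ∀ i, (σ : Gal(k⟮ζ⟯/k)) (d' i) = d' i ^ u.val.val := fun i => by
      obtain ⟨j, -, hj⟩ := hz.eq_pow_of_pow_eq_one (show d' i ^ N = 1 from Subtype.ext (hd i))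
      rw [← hj, map_pow, pow_right_comm, ← hz.autToPow_spec k (σ : Gal(k⟮ζ⟯/k))]
    simp_rw [hpow] at hfix
    simpa [d'] using congrArg k⟮ζ⟯.val hfix

end CyclotomicSubfield

theorem isCyclic_units_zmod_prime_pow {ℓ : ℕ} (hl : ℓ.Prime) (hodd : Odd ℓ) (e : ℕ) :
    IsCyclic (ZMod (ℓ ^ e))ˣ :=
  ZMod.isCyclic_units_of_prime_pow ℓ hl (by rintro rfl; exact absurd hodd (by decide)) e

theorem finrank_inf_mul_degreeT (K : IntermediateField ℚ ℂ) {ℓ : ℕ} (hl : ℓ.Prime) :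
    Module.finrank ℚ ↥(K ⊓ cyclo (ℓ ^ levelM K ℓ)) * degreeT K ℓ = (ℓ ^ levelM K ℓ).totient := by
  rw [← finrank_cyclo (pow_ne_zero _ hl.ne_zero), degreeT]
  exact finrank_bot_mul_relfinrank inf_le_right

theorem totient_prime_pow_add {ℓ a : ℕ} (hl : ℓ.Prime) (ha : 1 ≤ a) (b : ℕ) :
    (ℓ ^ (a + b)).totient = ℓ ^ b * (ℓ ^ a).totient := by
  rw [Nat.totient_prime_pow hl (by omega), Nat.totient_prime_pow hl (by omega), ← mul_assoc,
    ← pow_add]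
  congr 2
  omega

/-- For m = 1, t divides ℓ - 1. For m > 1, ℓ ∣ t would make the degree of K ∩ ℚ(ζ_{ℓ^m}) divide that
of ℚ(ζ_{ℓ^(m-1)}); cyclicity then puts this intersection in the smaller field, against the
minimality of m. -/
theorem not_dvd_degreeT (K : IntermediateField ℚ ℂ) [FiniteDimensional ℚ K] {ℓ : ℕ}
    (hl : ℓ.Prime) (hodd : Odd ℓ) : ¬ ℓ ∣ degreeT K ℓ := by
  rintro ⟨c, hc⟩
  obtain ⟨hm1, hm⟩ := levelM_mem K hl
  have hmin : ∀ k ∈ stableLevels K ℓ, levelM K ℓ ≤ k := fun k hk => Nat.sInf_le hk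
  have hdeg := finrank_inf_mul_degreeT K hl
  rw [hc] at hdeg
  generalize levelM K ℓ = m at *
  rcases hm1.eq_or_lt with rfl | hm2
  · rw [pow_one, Nat.totient_prime hl] at hdeg
    have h1 := Nat.le_of_dvd (Nat.sub_pos_of_lt hl.one_lt)
      ((Dvd.intro c rfl).trans (Dvd.intro_left _ hdeg))
    have := hl.one_lt
    omega
  obtain ⟨k, rfl⟩ : ∃ k, m = k + 1 := ⟨m - 1, by omega⟩
  have : NeZero (ℓ ^ (k + 1)) := ⟨pow_ne_zero _ hl.ne_zero⟩
  have := isCyclic_units_zmod_prime_pow hl hodd (k + 1)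
  have hle : cyclo (ℓ ^ k) ≤ cyclo (ℓ ^ (k + 1)) :=
    cyclo_mono (pow_ne_zero _ hl.ne_zero) (pow_dvd_pow ℓ k.le_succ)
  have hKle : K ⊓ cyclo (ℓ ^ (k + 1)) ≤ cyclo (ℓ ^ k) := by
    refine inf_adjoin_le_of_finrank_dvd_finrank (isPrimitiveRoot_zeta (NeZero.ne _)) ?_
    change _ ∣ Module.finrank ℚ ↥(cyclo (ℓ ^ k) ⊓ cyclo (ℓ ^ (k + 1)))
    rw [inf_eq_left.2 hle, finrank_cyclo (pow_ne_zero _ hl.ne_zero)]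
    rw [totient_prime_pow_add hl (by omega), pow_one] at hdeg
    refine ⟨c, Nat.eq_of_mul_eq_mul_left hl.pos (hdeg.symm.trans ?_)⟩
    change Module.finrank ℚ ↥(K ⊓ cyclo (ℓ ^ (k + 1))) * (ℓ * c) =
      ℓ * (Module.finrank ℚ ↥(K ⊓ cyclo (ℓ ^ (k + 1))) * c)
    ring
  have hk : k ∈ stableLevels K ℓ := by
    refine ⟨by omega, fun j hj => le_antisymm (le_inf inf_le_left ?_)
      (inf_le_inf_left K (cyclo_mono (pow_ne_zero _ hl.ne_zero) (pow_dvd_pow ℓ hj)))⟩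
    rcases hj.eq_or_lt with rfl | hj
    · exact inf_le_right
    · rw [hm j hj]
      exact hKle
  exact absurd (hmin k hk) (by omega)

/-- Beyond level m the intersection with K is constant, so each further level multiplies the
relative degree by ℓ. -/
theorem exists_pow_generator (K : IntermediateField ℚ ℂ) [FiniteDimensional ℚ K] {ℓ : ℕ}
    (hl : ℓ.Prime) (hodd : Odd ℓ) {e : ℕ} (he : levelM K ℓ ≤ e) :
    ∃ q : ℕ, q.Coprime ℓ ∧ orderOf (q : ZMod (ℓ ^ e)) = degreeT K ℓ * ℓ ^ (e - levelM K ℓ) ∧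
      ∀ {n : ℕ} (d : Fin n → ℂ), (∀ i, d i ^ ℓ ^ e = 1) → ∑ i, d i ∈ K →
        ∑ i, d i ^ q = ∑ i, d i := by
  obtain ⟨hm1, hm⟩ := levelM_mem K hl
  have hdeg := finrank_inf_mul_degreeT K hl
  have : NeZero (ℓ ^ e) := ⟨pow_ne_zero _ hl.ne_zero⟩
  have := isCyclic_units_zmod_prime_pow hl hodd e
  obtain ⟨q, hq, hord, h⟩ :=
    exists_pow_generator_adjoin (isPrimitiveRoot_zeta (pow_ne_zero e hl.ne_zero)) K
  refine ⟨q, (Nat.coprime_pow_right_iff (by omega) _ _).1 hq, ?_, h⟩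
  change orderOf (q : ZMod (ℓ ^ e)) * Module.finrank ℚ ↥(K ⊓ cyclo (ℓ ^ e)) =
    Module.finrank ℚ (cyclo (ℓ ^ e)) at hord
  obtain ⟨b, rfl⟩ := Nat.exists_eq_add_of_le he
  have hpos : 0 < Module.finrank ℚ ↥(K ⊓ cyclo (ℓ ^ levelM K ℓ)) := by
    rw [Nat.pos_iff_ne_zero]
    intro h0
    rw [h0, zero_mul] at hdeg
    exact (Nat.totient_pos.2 (pow_pos hl.pos _)).ne hdeg
  rw [hm _ he, finrank_cyclo (pow_ne_zero _ hl.ne_zero), totient_prime_pow_add hl hm1,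
    ← hdeg] at hord
  apply Nat.eq_of_mul_eq_mul_right hpos
  rw [hord, Nat.add_sub_cancel_left]
  ring

end SchurBound

/-! ### The ℓ-adic valuation of the product of the q^i - 1 -/

namespace SchurBound

/-- Each ℓ-th power gains a factor ℓ, since 1 + y + ⋯ + y^(ℓ-1) ≡ ℓ ≡ 0 modulo ℓ when y ≡ 1. -/
theorem pow_dvd_pow_sub_one {ℓ c : ℕ} {x : ℤ} (hc : 1 ≤ c) (h : (ℓ : ℤ) ^ c ∣ x - 1) (a : ℕ) :
    (ℓ : ℤ) ^ (c + a) ∣ x ^ ℓ ^ a - 1 := by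
  induction a with
  | zero => simpa using h
  | succ a ih =>
    have h1 : (ℓ : ℤ) ∣ x ^ ℓ ^ a - 1 := (dvd_pow_self _ (by omega)).trans ih
    have h2 := dvd_geom_sum₂_self h1
    simp only [one_pow, mul_one] at h2
    rw [pow_succ ℓ, pow_mul, ← geom_sum_mul, ← add_assoc, pow_succ, mul_comm]
    exact mul_dvd_mul h2 ih

theorem orderOf_dvd_of_pow_dvd_pow_sub_one {ℓ c e q i : ℕ} (hc : 1 ≤ c) (hce : c ≤ e)
    (h : (ℓ : ℤ) ^ c ∣ (q : ℤ) ^ i - 1) : orderOf (q : ZMod (ℓ ^ e)) ∣ i * ℓ ^ (e - c) := by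
  have h1 := pow_dvd_pow_sub_one hc h (e - c)
  rw [Nat.add_sub_cancel' hce] at h1
  rw [orderOf_dvd_iff_pow_eq_one, pow_mul, ← sub_eq_zero]
  have := (ZMod.intCast_zmod_eq_zero_iff_dvd _ (ℓ ^ e)).2 (by exact_mod_cast h1)
  exact_mod_cast this

/-- Too high a valuation of q^i - 1 would force the order of q modulo ℓ^e to be too small. -/
theorem padicValNat_pow_sub_one_le {ℓ e q m t n i : ℕ} (hl : ℓ.Prime) (hq : 1 < q) (hm : 1 ≤ m)
    (ht : ¬ ℓ ∣ t) (he : m + n < e) (hord : orderOf (q : ZMod (ℓ ^ e)) = t * ℓ ^ (e - m))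
    (hi : i ≠ 0) (hin : i ≤ n) :
    padicValNat ℓ (q ^ i - 1) ≤ if t ∣ i then m + padicValNat ℓ (i / t) else 0 := by
  have := Fact.mk hl
  have hne : q ^ i - 1 ≠ 0 := (Nat.sub_pos_of_lt (Nat.one_lt_pow hi hq)).ne'
  have key : ∀ c, 1 ≤ c → c ≤ e → c ≤ padicValNat ℓ (q ^ i - 1) →
      t * ℓ ^ (e - m) ∣ i * ℓ ^ (e - c) := by
    intro c hc hce hcv
    rw [← hord]
    refine orderOf_dvd_of_pow_dvd_pow_sub_one hc hce ?_
    have h1 := (padicValNat_dvd_iff_le hne).2 hcv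
    have h2 : ((q ^ i - 1 : ℕ) : ℤ) = (q : ℤ) ^ i - 1 := by
      rw [Nat.cast_sub (Nat.one_le_pow _ _ (by omega))]
      simp
    rw [← h2]
    exact_mod_cast h1
  have htpos : 0 < t := Nat.pos_of_ne_zero fun h => ht (h ▸ dvd_zero ℓ)
  split_ifs with hti
  · obtain ⟨j, rfl⟩ := hti
    rw [Nat.mul_div_cancel_left _ htpos]
    by_contra hlt
    have hj : j ≠ 0 := fun h => hi (by simp [h])
    have hjn : j ≤ n := (Nat.le_mul_of_pos_left j htpos).trans hin
    have hvn : padicValNat ℓ j < j := by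
      calc padicValNat ℓ j < ℓ ^ padicValNat ℓ j := Nat.lt_pow_self hl.one_lt
        _ ≤ j := Nat.le_of_dvd (Nat.pos_of_ne_zero hj) pow_padicValNat_dvd
    -- One more than the claimed bound; it is at most e because v(j) < j ≤ n and m + n < e.
    have h1 := key (m + padicValNat ℓ j + 1) (by omega) (by omega) (by omega)
    rw [mul_assoc] at h1
    have h2 := Nat.dvd_of_mul_dvd_mul_left htpos h1
    rw [show e - m = (padicValNat ℓ j + 1) + (e - (m + padicValNat ℓ j + 1)) by omega,
      pow_add] at h2
    exact pow_succ_padicValNat_not_dvd hj (Nat.dvd_of_mul_dvd_mul_right (pow_pos hl.pos _) h2)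
  · by_contra hpos
    exact hti (((Nat.coprime_pow_right_iff (n := e - 1)
      (by omega) t ℓ).2 ((Nat.Prime.coprime_iff_not_dvd hl).2 ht).symm).dvd_of_dvd_mul_right
      ((Dvd.intro _ rfl).trans (key 1 le_rfl (by omega) (by omega))))

theorem sum_ite_dvd_div (f : ℕ → ℕ) (n : ℕ) {t : ℕ} (ht : 0 < t) :
    ∑ i ∈ Finset.Icc 1 n, (if t ∣ i then f (i / t) else 0) = ∑ j ∈ Finset.Icc 1 (n / t), f j := by
  rw [← Finset.sum_filter]
  symm
  refine Finset.sum_bij (fun j _ => t * j) ?_ ?_ ?_ ?_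
  · intro j hj
    rw [Finset.mem_Icc, Nat.le_div_iff_mul_le ht] at hj
    rw [Finset.mem_filter, Finset.mem_Icc]
    exact ⟨⟨Nat.mul_pos ht hj.1, mul_comm j t ▸ hj.2⟩, Dvd.intro _ rfl⟩
  · intro j _ j' _ h
    exact Nat.eq_of_mul_eq_mul_left ht h
  · intro i hi
    rw [Finset.mem_filter, Finset.mem_Icc] at hi
    obtain ⟨⟨h1, h2⟩, j, rfl⟩ := hi
    refine ⟨j, ?_, rfl⟩
    rw [Finset.mem_Icc, Nat.le_div_iff_mul_le ht, mul_comm j t]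
    exact ⟨Nat.pos_of_mul_pos_left h1, h2⟩
  · intro j _
    rw [Nat.mul_div_cancel_left _ ht]

/-- Legendre's formula for N!. -/
theorem sum_padicValNat_eq_sum_div {ℓ : ℕ} (hl : ℓ.Prime) (N n : ℕ) (h : N ≤ n) :
    ∑ j ∈ Finset.Icc 1 N, padicValNat ℓ j = ∑ i ∈ Finset.Icc 1 n, N / ℓ ^ i := by
  have := Fact.mk hl
  have h1 : ∀ k, ∑ j ∈ Finset.Icc 1 k, padicValNat ℓ j = padicValNat ℓ k.factorial := by
    intro k
    induction k with
    | zero => simp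
    | succ k ih =>
      rw [Finset.sum_Icc_succ_top (by omega), ih, Nat.factorial_succ,
        padicValNat.mul (by omega) k.factorial_ne_zero, add_comm]
  rw [h1, padicValNat_factorial (b := n + 1) (Nat.lt_succ_of_le ((Nat.log_le_self ℓ N).trans h))]
  rfl

theorem padicValNat_prod_pow_sub_one_le {ℓ e q m t n : ℕ} (hl : ℓ.Prime) (hq : 1 < q) (hm : 1 ≤ m)
    (ht : ¬ ℓ ∣ t) (he : m + n < e) (hord : orderOf (q : ZMod (ℓ ^ e)) = t * ℓ ^ (e - m)) :
    padicValNat ℓ (∏ i ∈ Finset.Icc 1 n, (q ^ i - 1)) ≤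
      m * (n / t) + ∑ i ∈ Finset.Icc 1 n, n / (ℓ ^ i * t) := by
  have := Fact.mk hl
  have htpos : 0 < t := Nat.pos_of_ne_zero fun h => ht (h ▸ dvd_zero ℓ)
  have hne : ∀ i ∈ Finset.Icc 1 n, q ^ i - 1 ≠ 0 := fun i hi =>
    (Nat.sub_pos_of_lt (Nat.one_lt_pow (by rw [Finset.mem_Icc] at hi; omega) hq)).ne'
  have hprod : padicValNat ℓ (∏ i ∈ Finset.Icc 1 n, (q ^ i - 1)) =
      ∑ i ∈ Finset.Icc 1 n, padicValNat ℓ (q ^ i - 1) := by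
    simp_rw [← Nat.factorization_def _ hl]
    rw [Nat.factorization_prod hne, Finset.sum_apply']
  rw [hprod]
  calc ∑ i ∈ Finset.Icc 1 n, padicValNat ℓ (q ^ i - 1)
      ≤ ∑ i ∈ Finset.Icc 1 n, (if t ∣ i then m + padicValNat ℓ (i / t) else 0) := by
        refine Finset.sum_le_sum fun i hi => ?_
        rw [Finset.mem_Icc] at hi
        exact padicValNat_pow_sub_one_le hl hq hm ht he hord (by omega) hi.2
    _ = ∑ j ∈ Finset.Icc 1 (n / t), (m + padicValNat ℓ j) :=
        sum_ite_dvd_div (fun j => m + padicValNat ℓ j) n htpos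
    _ = m * (n / t) + ∑ i ∈ Finset.Icc 1 n, n / (ℓ ^ i * t) := by
        rw [Finset.sum_add_distrib, sum_padicValNat_eq_sum_div hl _ n (Nat.div_le_self n t)]
        simp [mul_comm, Nat.div_div_eq_div_mul]

/-- The two products differ by a power of q, which is prime to ℓ. -/
theorem pow_dvd_prod_pow_sub_one {ℓ a q n : ℕ} (hq : 1 < q) (hc : q.Coprime ℓ)
    (h : ((ℓ ^ a : ℕ) : ℤ) ∣ ∏ i ∈ Finset.range n, ((q : ℤ) ^ n - (q : ℤ) ^ i)) :
    ℓ ^ a ∣ ∏ i ∈ Finset.Icc 1 n, (q ^ i - 1) := by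
  have h1 : ∏ i ∈ Finset.range n, ((q : ℤ) ^ n - (q : ℤ) ^ i) =
      (((∏ i ∈ Finset.range n, q ^ i) * ∏ i ∈ Finset.Icc 1 n, (q ^ i - 1) : ℕ) : ℤ) := by
    have h2 : ∏ i ∈ Finset.Icc 1 n, (q ^ i - 1) = ∏ i ∈ Finset.range n, (q ^ (n - i) - 1) := by
      refine Finset.prod_nbij' (n - ·) (n - ·) ?_ ?_ ?_ ?_ ?_ <;> intro i hi <;>
        simp only [Finset.mem_Icc, Finset.mem_range] at hi ⊢
      any_goals omega
      rw [Nat.sub_sub_self hi.2]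
    rw [h2, ← Finset.prod_mul_distrib, Nat.cast_prod]
    refine Finset.prod_congr rfl fun i hi => ?_
    rw [Finset.mem_range] at hi
    rw [Nat.mul_sub, ← pow_add, Nat.add_sub_cancel' hi.le, mul_one,
      Nat.cast_sub (Nat.pow_le_pow_right (by omega) hi.le)]
    push_cast
    rfl
  rw [h1, Int.natCast_dvd_natCast] at h
  exact (Nat.Coprime.pow_left a (Nat.Coprime.prod_right fun i _ =>
    (hc.symm.pow_right i))).dvd_of_dvd_mul_left h

theorem dvd_finprod_of_finite_mulSupport {ι : Type*} {f : ι → ℕ}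
    (hf : (Function.mulSupport f).Finite) (i : ι) : f i ∣ ∏ᶠ j, f j := by
  by_cases hi : f i = 1
  · rw [hi]
    exact one_dvd _
  · rw [finprod_eq_prod _ hf]
    exact Finset.dvd_prod_of_mem f (hf.mem_toFinset.2 hi)

theorem pow_schurExponent_dvd_schurConstant (n : ℕ) (K : IntermediateField ℚ ℂ)
    [FiniteDimensional ℚ K] {ℓ : ℕ} (hl : ℓ.Prime) :
    ℓ ^ schurExponent n K ℓ ∣ schurConstant n K :=
  (dvd_finprod_of_finite_mulSupport (finite_mulSupport n K) ⟨ℓ, hl⟩).mul_left _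

end SchurBound

/-! ### Assembly of the bound -/

theorem mainTheorem3 (n : ℕ) (K : IntermediateField ℚ ℂ) [FiniteDimensional ℚ K]
    (G : Subgroup (GL (Fin n) ℂ)) [Finite G]
    (htr : ∀ g ∈ G, Matrix.trace (g : Matrix (Fin n) (Fin n) ℂ) ∈ K)
    (ℓ : ℕ) (hℓ : ℓ.Prime) (hodd : Odd ℓ) :
    ordProj[ℓ] (Nat.card G) ∣ SchurBound.schurConstant n K := by
  open SchurBound in
  have := Fact.mk hℓ
  refine dvd_trans (pow_dvd_pow ℓ ?_) (pow_schurExponent_dvd_schurConstant n K hℓ)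
  obtain ⟨P, hP⟩ := Sylow.exists_subgroup_card_pow_prime ℓ (Nat.ordProj_dvd (Nat.card G) ℓ)
  generalize (Nat.card G).factorization ℓ = a at *
  have := Fintype.ofFinite P
  rw [Nat.card_eq_fintype_card] at hP
  have hm := (levelM_mem K hℓ).1
  have ht := not_dvd_degreeT K hℓ hodd
  -- The level e exceeds m + n, as the valuation bound requires, and a, so that ℓ^e kills P; e > m
  -- also rules out q = 1, whose order is 1.
  obtain ⟨q, hq, hord, hsum⟩ := exists_pow_generator K hℓ hodd
    (e := levelM K ℓ + n + a + 1) (by omega)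
  have hq1 : 1 < q := by
    by_contra hle
    interval_cases q
    · rw [Nat.coprime_zero_left] at hq
      exact hℓ.one_lt.ne' hq
    · rw [Nat.cast_one, orderOf_one] at hord
      have h1 := Nat.eq_one_of_mul_eq_one_left hord.symm
      rw [Nat.pow_eq_one] at h1
      have := hℓ.one_lt
      omega
  let ρ : P →* Matrix (Fin n) (Fin n) ℂ :=
    (Units.coeHom _).comp (G.subtype.comp P.subtype)
  have hρ : Function.Injective ρ :=
    Units.val_injective.comp (Subtype.val_injective.comp Subtype.val_injective)
  have hdvd := card_dvd_prod_pow_sub_pow (q := q) ρ hρ (hP ▸ hq.pow_right a) fun g => by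
    have hone : g ^ ℓ ^ (levelM K ℓ + n + a + 1) = 1 := by
      rw [← orderOf_dvd_iff_pow_eq_one]
      exact orderOf_dvd_card.trans (hP ▸ pow_dvd_pow ℓ (by omega))
    have hpow : ρ g ^ ℓ ^ (levelM K ℓ + n + a + 1) = 1 := by rw [← map_pow, hone, map_one]
    obtain ⟨d, hd⟩ := exists_isDiagonalization (pow_ne_zero _ hℓ.ne_zero) hpow
    have h1 := (hd.pow q).trace_eq
    rw [← map_pow] at h1
    rw [h1, hd.trace_eq]
    refine hsum d (fun i => congrFun ((hd.pow _).eq_one_iff.1 hpow) i) ?_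
    rw [← hd.trace_eq]
    exact htr _ (g : G).2
  rw [hP] at hdvd
  have hdvd' := pow_dvd_prod_pow_sub_one hq1 hq hdvd
  refine le_trans ?_ (padicValNat_prod_pow_sub_one_le (n := n) hℓ hq1 hm ht (by omega) hord)
  refine (padicValNat_dvd_iff_le (Finset.prod_ne_zero_iff.2 fun i hi => ?_)).1 hdvd'
  rw [Finset.mem_Icc] at hi
  exact (Nat.sub_pos_of_lt (Nat.one_lt_pow (by omega) hq1)).ne'
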